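/- \textbf{Setting.} Let $R:\mathbb R\times\mathbb R^m\to\mathbb R^m$ and $G:\mathbb R^m\to\mathbb R$ be infinitely differentiable, let $T>0$, and let $q:[0,T]\to\mathbb R^m$ solve $q'(t)=R(t,q(t))$, with the system dissipative along $q$: $\frac{d}{dt}G(q(t))=\nabla G(q(t))^TR(t,q(t))<0$ for all $t\in[0,T]$. Consider an explicit $s$-stage Runge--Kutta method with coefficients $a_{ij}$ ($a_{ij}=0$ for $j\ge i$), weights $b_j$ and $c_i=\sum_j a_{ij}$. A step of size $\Delta t$ from $q^n$ at time $t_n$ is $$q_i=q^n+\Delta t\sum_j a_{ij}R_j,\qquad R_i=R(t_n+c_i\Delta t,q_i),\qquad q^{n+1}=q^n+\Delta t\sum_j b_jR_j .$$ The method has order (at least) $p$ if, for every infinitely differentiable system in any dimension and every solution $y$ on an interval $[t_0,t_1]$, $t_0<t_1$, the step of size $\Delta t$ from $(t_0,y(t_0))$ differs from $y(t_0+\Delta t)$ by $\mathcal O(\Delta t^{p+1})$ as $\Delta t\to0^+$. Let $\nabla G_s$ be the orthogonal projection of $\nabla G(q^{n+1})$ onto $\mathcal S=\mathrm{span}(R_1,\dots,R_s)$.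 When $\nabla G_s\ne0$, the quasi-orthogonal projection method replaces $q^{n+1}$ by $$\hat q^{n+1}=q^{n+1}+\lambda_n\frac{\nabla G_s}{\|\nabla G_s\|_2},\qquad\text{where } G(\hat q^{n+1})=G(q^n)+\Delta t\sum_{i=1}^s b_i\,\nabla G(q_i)^TR_i. \tag{$*$}$$ \textbf{Theorem.} Suppose that the explicit Runge--Kutta method has order at least $p$, where $p\ge2$. Then there are $h^*>0$, $r>0$, $\rho>0$ and $C>0$ such that the following hold for every $\Delta t\in(0,h^*]$. (i) (One step.) For every $t_n\in[0,T]$ and every $q^n$ with $\|q^n-q(t_n)\|_2\le r$: $\nabla G_s\neq0$; equation $(*)$ has exactly one solution $\lambda_n$ with $|\lambda_n|\le\rho$; the system has a solution $z$ on $[t_n,t_n+\Delta t]$ with $z(t_n)=q^n$; and with this $\lambda_n$ the local error satisfies $\|\hat q^{n+1}-z(t_n+\Delta t)\|_2\le C\Delta t^{p+1}$. (ii) (Integration.) For every $N$ with $N\Delta t\le T$, $N$ steps of the projection method, each starting from the projected value of the previous one, can be carried out from $q^0=q(0)$ at time $0$, with $\nabla G_s\ne0$ and $|\lambda_n|\le\rho$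 at each step. Any values $\hat q^0=q(0),\hat q^1,\dots,\hat q^N$ so produced satisfy $\|\hat q^n-q(n\Delta t)\|_2\le r$ and $\|\hat q^n-q(n\Delta t)\|_2\le C\Delta t^{p}$ for $0\le n\le N$. In particular, the projection method is solvable for all $\Delta t\in(0,h^*]$ and its order of accuracy is at least $p$. -/

import Mathlib

open scoped ContDiff Topology

noncomputable section

/-- An explicit Runge-Kutta method with `s` stages: coefficients `a i j` with `a i j = 0` for
`j ≥ i`, and weights `b j`. -/
structure ExplicitRK (s : ℕ) where
  a : Fin s → Fin s → ℝ
  b : Fin s → ℝ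
  explicit : ∀ i j : Fin s, i ≤ j → a i j = 0

namespace ExplicitRK

variable {s : ℕ} {E : Type*}

/-- The abscissae `c i = ∑ j, a i j`. -/
def c (M : ExplicitRK s) (i : Fin s) : ℝ := ∑ j, M.a i j

section Stages

variable [AddCommGroup E] [Module ℝ E]

/-- The stage derivatives `R_i = R (t + c i * h, x + h * ∑ j, a i j * R_j)` of one step of size `h`
from the point `x` at time `t`. As the method is explicit, they are computed recursively, and only
the terms with `j < i` occur in the sum (see `stageDeriv_eq`). -/
def stageDeriv (M : ExplicitRK s) (R : ℝ → E → E) (t : ℝ) (x : E) (h : ℝ) (i : Fin s) : E :=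
  R (t + M.c i * h) (x + h • ∑ j : {j : Fin s // j < i}, M.a i j.1 • M.stageDeriv R t x h j.1)
termination_by i.val
decreasing_by exact j.2

/-- The stage values `q_i = x + h * ∑ j, a i j * R_j`. -/
def stageValue (M : ExplicitRK s) (R : ℝ → E → E) (t : ℝ) (x : E) (h : ℝ) (i : Fin s) : E :=
  x + h • ∑ j, M.a i j • M.stageDeriv R t x h j

/-- The Runge-Kutta update `x + h * ∑ j, b j * R_j`. -/
def step (M : ExplicitRK s) (R : ℝ → E → E) (t : ℝ) (x : E) (h : ℝ) : E :=
  x + h • ∑ j, M.b j • M.stageDeriv R t x h j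

/-- The stage equations hold in the usual form. -/
theorem stageDeriv_eq (M : ExplicitRK s) (R : ℝ → E → E) (t : ℝ) (x : E) (h : ℝ) (i : Fin s) :
    M.stageDeriv R t x h i = R (t + M.c i * h) (M.stageValue R t x h i) := by
  rw [stageDeriv, stageValue]
  congr 3
  rw [← Finset.sum_subtype (Finset.univ.filter (fun j => j < i)) (by simp)
    (fun j => M.a i j • M.stageDeriv R t x h j), Finset.sum_filter]
  refine Finset.sum_congr rfl fun j _ => ?_
  split_ifs with hj
  · rfl
  · rw [M.explicit i j (not_lt.mp hj), zero_smul]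

end Stages

end ExplicitRK

/-- `y` solves `y' = R (t, y)` on the closed interval `[t₀, t₁]` (one-sided derivatives at the
end points). -/
def IsSolutionOn {E : Type*} [NormedAddCommGroup E] [NormedSpace ℝ E]
    (R : ℝ → E → E) (y : ℝ → E) (t₀ t₁ : ℝ) : Prop :=
  ∀ t ∈ Set.Icc t₀ t₁, HasDerivWithinAt y (R t (y t)) (Set.Icc t₀ t₁) t

namespace ExplicitRK

variable {s m : ℕ}

/-- The method has order (at least) `p`: for every smooth system, in any dimension, the local
error after one step of size `h` from the exact solution is `O(h ^ (p + 1))` as `h → 0+`. -/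
def HasOrder (M : ExplicitRK s) (p : ℕ) : Prop :=
  ∀ (d : ℕ) (R : ℝ → EuclideanSpace ℝ (Fin d) → EuclideanSpace ℝ (Fin d)),
    ContDiff ℝ ∞ (fun z : ℝ × EuclideanSpace ℝ (Fin d) => R z.1 z.2) →
    ∀ (t₀ t₁ : ℝ) (y : ℝ → EuclideanSpace ℝ (Fin d)), t₀ < t₁ → IsSolutionOn R y t₀ t₁ →
      (fun h : ℝ => y (t₀ + h) - M.step R t₀ (y t₀) h) =O[𝓝[>] 0] fun h : ℝ => h ^ (p + 1)

/-- The subspace `𝒮` spanned by the stage derivatives. -/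
def stageSpan (M : ExplicitRK s)
    (R : ℝ → EuclideanSpace ℝ (Fin m) → EuclideanSpace ℝ (Fin m))
    (t : ℝ) (x : EuclideanSpace ℝ (Fin m)) (h : ℝ) : Submodule ℝ (EuclideanSpace ℝ (Fin m)) :=
  Submodule.span ℝ (Set.range (M.stageDeriv R t x h))

/-- `∇G_s`: the component in `𝒮` of the gradient of `G` at the Runge-Kutta update, i.e. the
orthogonal projection of that gradient onto `𝒮`. -/
def gradS (M : ExplicitRK s)
    (R : ℝ → EuclideanSpace ℝ (Fin m) → EuclideanSpace ℝ (Fin m))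
    (G : EuclideanSpace ℝ (Fin m) → ℝ)
    (t : ℝ) (x : EuclideanSpace ℝ (Fin m)) (h : ℝ) : EuclideanSpace ℝ (Fin m) :=
  (M.stageSpan R t x h).starProjection (gradient G (M.step R t x h))

/-- The point `q^{n+1} + lam * ∇G_s / ‖∇G_s‖` (used only where `∇G_s ≠ 0`). -/
def projected (M : ExplicitRK s)
    (R : ℝ → EuclideanSpace ℝ (Fin m) → EuclideanSpace ℝ (Fin m))
    (G : EuclideanSpace ℝ (Fin m) → ℝ)
    (t : ℝ) (x : EuclideanSpace ℝ (Fin m)) (h lam : ℝ) : EuclideanSpace ℝ (Fin m) :=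
  M.step R t x h + lam • (‖M.gradS R G t x h‖⁻¹ • M.gradS R G t x h)

/-- The target value `G(q^n) + h * ∑ i, b i * ∇G(q_i)ᵀ R_i`. -/
def target (M : ExplicitRK s)
    (R : ℝ → EuclideanSpace ℝ (Fin m) → EuclideanSpace ℝ (Fin m))
    (G : EuclideanSpace ℝ (Fin m) → ℝ)
    (t : ℝ) (x : EuclideanSpace ℝ (Fin m)) (h : ℝ) : ℝ :=
  G x + h * ∑ i, M.b i *
    inner ℝ (gradient G (M.stageValue R t x h i)) (M.stageDeriv R t x h i)

/-- `lam` solves the scalar projection equation of the step of size `h` from `x` at time `t`. -/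
def IsProjectionParam (M : ExplicitRK s)
    (R : ℝ → EuclideanSpace ℝ (Fin m) → EuclideanSpace ℝ (Fin m))
    (G : EuclideanSpace ℝ (Fin m) → ℝ)
    (t : ℝ) (x : EuclideanSpace ℝ (Fin m)) (h lam : ℝ) : Prop :=
  G (M.projected R G t x h lam) = M.target R G t x h

/-- `Q 0, …, Q N` is produced by `N` steps of size `h` of the quasi-orthogonal projection method
from `Q 0 = x₀` at time `0`, with projection parameters of absolute value at most `ρ`. -/
def IsProjectedRun (M : ExplicitRK s)
    (R : ℝ → EuclideanSpace ℝ (Fin m) → EuclideanSpace ℝ (Fin m))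
    (G : EuclideanSpace ℝ (Fin m) → ℝ)
    (x₀ : EuclideanSpace ℝ (Fin m)) (h ρ : ℝ) (N : ℕ)
    (Q : ℕ → EuclideanSpace ℝ (Fin m)) : Prop :=
  Q 0 = x₀ ∧ ∀ n < N,
    M.gradS R G (n * h) (Q n) h ≠ 0 ∧
    ∃ lam : ℝ, |lam| ≤ ρ ∧ M.IsProjectionParam R G (n * h) (Q n) h lam ∧
      Q (n + 1) = M.projected R G (n * h) (Q n) h lam

end ExplicitRK

end

noncomputable section

open Set Filter Asymptotics

/-! The target of the projection equation is itself a Runge-Kutta value. Adjoin to the system a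
scalar `w` with `w' = dG(y) R(t, y)` and initial value `G(q^n)`. The exact `w` is `G` along the
solution, while the method applied to the enlarged system returns the pair (update, target). Since
the order hypothesis covers every smooth system, update and target are both accurate to `h ^ (p +
1)` (`exists_uniform_localError_target`), so the projection equation has a residual of that size at
`lam = 0`.

The first stage of an explicit method is `R(t, q^n)`. It lies in the stage span, and near the
solution `G` decreases along it at a definite rate. This bounds `‖∇G_s‖` below, so the scalar
equation has slope bounded below on a fixed interval. Its root there exists, is unique and is `O(h ^
(p + 1))` (`existsUnique_projection`), so projecting preserves the local order.

Order is assumed only asymptotically, for each solution separately; uniform constants come from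
smoothness. A function that is `O(u ^ n)` with `n`-th derivative bounded by `B` is at most `B * u ^
n` (`norm_le_of_isBigO_of_deriv_bound`), and for the local error the derivative is bounded by
compactness (`exists_uniform_localError`).

Globally, the exact flow carries earlier errors forward with factor `exp (L * h)` per step. The
accumulated `O(h ^ p)` error stays below the tube radius for small `h`, so every run remains where
the one-step result applies. -/

/-- A continuous function is bounded on compact sets. -/
theorem exists_norm_le_of_isCompact {X F : Type*} [TopologicalSpace X]
    [NormedAddCommGroup F] {K : Set X} (hK : IsCompact K) {Φ : X → F}
    (hΦ : Continuous Φ) : ∃ B : ℝ, 0 < B ∧ ∀ x ∈ K, ‖Φ x‖ ≤ B := by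
  obtain ⟨B, hB⟩ := hK.exists_bound_of_continuousOn hΦ.continuousOn
  exact ⟨max B 1, by positivity, fun x hx => (hB x hx).trans (le_max_left _ _)⟩

/-- **Picard-Lindelöf theorem** with control of the range of the solution. -/
theorem IsPicardLindelof.exists_solution_mem_closedBall {E : Type*} [NormedAddCommGroup E]
    [NormedSpace ℝ E] [CompleteSpace E] {f : ℝ → E → E} {tmin tmax : ℝ} {t₀ : Icc tmin tmax}
    {x₀ x : E} {a r L K : NNReal} (hf : IsPicardLindelof f t₀ x₀ a r L K)
    (hx : x ∈ Metric.closedBall x₀ r) :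
    ∃ α : ℝ → E, α t₀ = x ∧
      (∀ t ∈ Icc tmin tmax, HasDerivWithinAt α (f t (α t)) (Icc tmin tmax) t) ∧
      ∀ t, α t ∈ Metric.closedBall x₀ a := by
  obtain ⟨α, hα⟩ := ODE.FunSpace.exists_isFixedPt_next hf hx
  refine ⟨α.compProj, by rw [ODE.FunSpace.compProj_val, ← hα, ODE.FunSpace.next_apply₀],
    fun t ht => ?_, fun t => α.compProj_mem_closedBall hf.mul_max_le⟩
  apply ODE.hasDerivWithinAt_picard_Icc t₀.2 hf.continuousOn_uncurry
    α.continuous_compProj.continuousOn (fun _ _ => α.compProj_mem_closedBall hf.mul_max_le)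
    x ht |>.congr_of_mem _ ht
  intro t' ht'
  nth_rw 1 [← hα]
  rw [ODE.FunSpace.compProj_of_mem ht', ODE.FunSpace.next_apply]

/-! ### Taylor estimates and solutions of smooth systems -/

section Analysis

variable {X E F : Type*} [NormedAddCommGroup X] [NormedSpace ℝ X]
  [NormedAddCommGroup E] [NormedSpace ℝ E] [NormedAddCommGroup F] [NormedSpace ℝ F]

/-- The `k`-th iterated derivative of `Φ` along the vector field `v`. -/
def iterDerivAlong (v : X → X) (Φ : X → F) : ℕ → X → F
  | 0 => Φ
  | k + 1 => fun x => fderiv ℝ (iterDerivAlong v Φ k) x (v x)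

theorem contDiff_iterDerivAlong {v : X → X} {Φ : X → F} (hv : ContDiff ℝ ∞ v)
    (hΦ : ContDiff ℝ ∞ Φ) (k : ℕ) : ContDiff ℝ ∞ (iterDerivAlong v Φ k) := by
  induction k with
  | zero => exact hΦ
  | succ k ih => exact (ih.fderiv_right (m := ∞) (by simp)).clm_apply hv

theorem hasDerivWithinAt_iterDerivAlong {v : X → X} {Φ : X → F} (hv : ContDiff ℝ ∞ v)
    (hΦ : ContDiff ℝ ∞ Φ) (k : ℕ) {γ : ℝ → X} {s : Set ℝ} {t : ℝ}
    (hγ : HasDerivWithinAt γ (v (γ t)) s t) :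
    HasDerivWithinAt (fun u => iterDerivAlong v Φ k (γ u))
      (iterDerivAlong v Φ (k + 1) (γ t)) s t :=
  (((contDiff_iterDerivAlong hv hΦ k).differentiable (by simp)
    (γ t)).hasFDerivAt).comp_hasDerivWithinAt t hγ

/-- Taylor's formula on `[0, b]` for a sequence of successive derivatives. -/
theorem norm_sub_taylor_le {b B : ℝ} {n : ℕ} {e : ℕ → ℝ → F}
    (he : ∀ k < n, ∀ u ∈ Icc 0 b, HasDerivWithinAt (e k) (e (k + 1) u) (Icc 0 b) u)
    (hB : ∀ u ∈ Icc 0 b, ‖e n u‖ ≤ B) {u : ℝ} (hu : u ∈ Icc 0 b) :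
    ‖e 0 u - ∑ k ∈ Finset.range n, u ^ k • ((k.factorial : ℝ)⁻¹ • e k 0)‖ ≤ B * u ^ n := by
  induction n generalizing e u with
  | zero => simpa using hB u hu
  | succ n ih =>
    -- The derivative of the Taylor remainder of `e 0` is the remainder of `e 1` of one order less;
    -- the mean value inequality then gains the factor `u`, without the factorial.
    have ih' := fun {w} hw => ih (e := fun k => e (k + 1)) (u := w)
      (fun k hk => he (k + 1) (by omega)) hB hw
    have hB0 : 0 ≤ B := (norm_nonneg _).trans (hB u hu)
    have hsub : Icc 0 u ⊆ Icc 0 b := Icc_subset_Icc_right hu.2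
    have hder : ∀ w ∈ Icc 0 u, HasDerivWithinAt
        (fun u => e 0 u - ∑ k ∈ Finset.range (n + 1), u ^ k • ((k.factorial : ℝ)⁻¹ • e k 0))
        (e 1 w - ∑ k ∈ Finset.range n, w ^ k • ((k.factorial : ℝ)⁻¹ • e (k + 1) 0))
        (Icc 0 u) w := by
      intro w hw
      refine ((he 0 (by omega) w (hsub hw)).mono hsub).sub ?_
      have h1 := HasDerivWithinAt.fun_sum (u := Finset.range (n + 1)) (s := Icc 0 u) (x := w)
        (A := fun k (u : ℝ) => u ^ k • ((k.factorial : ℝ)⁻¹ • e k 0))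
        (fun k _ => ((hasDerivAt_pow k w).hasDerivWithinAt.smul_const _))
      convert h1 using 1
      rw [Finset.sum_range_succ']
      simp only [Nat.cast_zero, zero_mul, zero_smul, add_zero]
      refine Finset.sum_congr rfl fun k _ => ?_
      rw [smul_smul, smul_smul, Nat.factorial_succ]
      congr 1
      have : (k.factorial : ℝ) ≠ 0 := by positivity
      push_cast
      field_simp
    have hmain := norm_image_sub_le_of_norm_deriv_le_segment' (C := B * u ^ n) hder
      (fun w hw => (ih' (hsub (Ico_subset_Icc_self hw))).trans
        (mul_le_mul_of_nonneg_left (pow_le_pow_left₀ hw.1 hw.2.le n) hB0)) u ⟨hu.1, le_rfl⟩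
    have h0 : ∑ k ∈ Finset.range (n + 1), (0 : ℝ) ^ k • ((k.factorial : ℝ)⁻¹ • e k 0) = e 0 0 := by
      rw [Finset.sum_range_succ']
      simp
    rw [h0, sub_self, sub_zero, sub_zero] at hmain
    rwa [pow_succ, ← mul_assoc]

/-- A polynomial of degree less than `n` which is `O(u ^ n)` at `0` is zero. -/
theorem coeff_eq_zero_of_isBigO {n : ℕ} {c : ℕ → F}
    (hc : (fun u : ℝ => ∑ k ∈ Finset.range n, u ^ k • c k) =O[𝓝[>] 0] fun u : ℝ => u ^ n) :
    ∀ k < n, c k = 0 := by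
  induction n generalizing c with
  | zero => intro k hk; omega
  | succ n ih =>
    have hlim : Tendsto (fun u : ℝ => ∑ k ∈ Finset.range (n + 1), u ^ k • c k) (𝓝[>] 0)
        (𝓝 (∑ k ∈ Finset.range (n + 1), (0 : ℝ) ^ k • c k)) :=
      ((continuous_finsetSum _ fun k _ => (continuous_pow k).smul continuous_const).tendsto
        0).mono_left nhdsWithin_le_nhds
    have hz : Tendsto (fun u : ℝ => u ^ (n + 1)) (𝓝[>] 0) (𝓝 0) := by
      have := ((continuous_pow (n + 1) (M := ℝ)).tendsto 0).mono_left
        (nhdsWithin_le_nhds (s := Ioi 0))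
      simpa using this
    have h0 : c 0 = 0 := by
      have := tendsto_nhds_unique hlim (hc.trans_tendsto hz)
      rw [Finset.sum_range_succ'] at this
      simpa using this
    -- With the constant term gone, both sides can be divided by `u`.
    have hc' : (fun u : ℝ => ∑ k ∈ Finset.range n, u ^ k • c (k + 1)) =O[𝓝[>] 0]
        fun u : ℝ => u ^ n := by
      obtain ⟨K, hK⟩ := hc.bound
      refine IsBigO.of_bound K ?_
      filter_upwards [hK, self_mem_nhdsWithin] with u hu hu0
      have hu0 : (0 : ℝ) < u := hu0
      have hs : ∑ k ∈ Finset.range (n + 1), u ^ k • c k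
          = u • ∑ k ∈ Finset.range n, u ^ k • c (k + 1) := by
        rw [Finset.sum_range_succ', h0, smul_zero, add_zero, Finset.smul_sum]
        exact Finset.sum_congr rfl fun k _ => by rw [smul_smul, pow_succ']
      rw [hs, norm_smul, pow_succ', norm_mul, mul_left_comm] at hu
      exact le_of_mul_le_mul_left hu (norm_pos_iff.2 hu0.ne')
    intro k hk
    cases k with
    | zero => exact h0
    | succ k => exact ih hc' k (by omega)

/-- A function on `[0, b]` that is `O(u ^ n)` at `0` and whose `n`-th derivative is bounded by `B`
is bounded by `B * u ^ n`. -/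
theorem norm_le_of_isBigO_of_deriv_bound {b B : ℝ} (hb : 0 < b) {n : ℕ} {e : ℕ → ℝ → F}
    (he : ∀ k < n, ∀ u ∈ Icc 0 b, HasDerivWithinAt (e k) (e (k + 1) u) (Icc 0 b) u)
    (hB : ∀ u ∈ Icc 0 b, ‖e n u‖ ≤ B) (hO : e 0 =O[𝓝[>] 0] fun u : ℝ => u ^ n)
    {u : ℝ} (hu : u ∈ Icc 0 b) : ‖e 0 u‖ ≤ B * u ^ n := by
  have hT := fun {w} hw => norm_sub_taylor_le (u := w) he hB hw
  -- The function and its Taylor remainder are both `O(u ^ n)`, hence so is the Taylor polynomial,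
  -- which must vanish. The unknown constant in `hO` is thereby replaced by `B`.
  have hO2 : (fun u => e 0 u - ∑ k ∈ Finset.range n, u ^ k • ((k.factorial : ℝ)⁻¹ • e k 0))
      =O[𝓝[>] 0] fun u : ℝ => u ^ n := by
    refine IsBigO.of_bound B ?_
    filter_upwards [Ioc_mem_nhdsGT hb] with w hw
    have := hT ⟨hw.1.le, hw.2⟩
    rwa [Real.norm_of_nonneg (pow_nonneg hw.1.le n)]
  have hc := coeff_eq_zero_of_isBigO (c := fun k => (k.factorial : ℝ)⁻¹ • e k 0)
    ((hO.sub hO2).congr_left fun u => by simp)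
  have := hT hu
  rw [Finset.sum_eq_zero fun k hk => ?_, sub_zero] at this
  · exact this
  · have := hc k (Finset.mem_range.1 hk)
    rw [this, smul_zero]

/-- A smooth time-dependent function is Lipschitz in space on bounded sets, uniformly in time on
bounded intervals. -/
theorem exists_lipschitzOnWith_closedBall [FiniteDimensional ℝ E] {Φ : ℝ → E → F}
    (hΦ : ContDiff ℝ ∞ fun z : ℝ × E => Φ z.1 z.2) (a b ρ : ℝ) :
    ∃ L : NNReal, ∀ t ∈ Icc a b, LipschitzOnWith L (Φ t) (Metric.closedBall 0 ρ) := by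
  have hcont : Continuous fun z : ℝ × E => fderiv ℝ (fun z : ℝ × E => Φ z.1 z.2) z :=
    hΦ.continuous_fderiv (by simp)
  have : ProperSpace E := FiniteDimensional.proper ℝ E
  obtain ⟨B, hB0, hB⟩ := exists_norm_le_of_isCompact
    ((isCompact_Icc (a := a) (b := b)).prod (isCompact_closedBall (0 : E) ρ)) hcont
  lift B to NNReal using hB0.le
  refine ⟨B, fun t ht => ?_⟩
  refine (convex_closedBall (0 : E) ρ).lipschitzOnWith_of_nnnorm_hasFDerivWithin_le
    (f' := fun x => (fderiv ℝ (fun z : ℝ × E => Φ z.1 z.2) (t, x)).comp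
      (ContinuousLinearMap.inr ℝ ℝ E)) (fun x _ => ?_) fun x hx => ?_
  · exact ((hΦ.differentiable (by simp) (t, x)).hasFDerivAt.comp x
      (hasFDerivAt_prodMk_right (𝕜 := ℝ) t x)).hasFDerivWithinAt
  · rw [← NNReal.coe_le_coe, coe_nnnorm]
    refine ContinuousLinearMap.opNorm_le_bound _ hB0.le fun y => ?_
    rw [ContinuousLinearMap.comp_apply]
    refine (ContinuousLinearMap.le_opNorm _ _).trans ?_
    have : ‖(ContinuousLinearMap.inr ℝ ℝ E) y‖ = ‖y‖ := by simp [Prod.norm_def]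
    rw [this]
    exact mul_le_mul_of_nonneg_right (hB (t, x) ⟨ht, hx⟩) (norm_nonneg _)

/-- Solutions of a smooth system exist on time intervals of uniform length for bounded initial data,
and stay in the unit ball around the initial point. -/
theorem exists_isSolutionOn_uniform [FiniteDimensional ℝ E] {R : ℝ → E → E}
    (hR : ContDiff ℝ ∞ fun z : ℝ × E => R z.1 z.2) (T ρ : ℝ) :
    ∃ h₀ : ℝ, 0 < h₀ ∧ h₀ ≤ 1 ∧ ∀ t ∈ Icc 0 T, ∀ x : E, ‖x‖ ≤ ρ → ∃ z : ℝ → E, z t = x ∧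
      IsSolutionOn R z t (t + h₀) ∧ ∀ u, z u ∈ Metric.closedBall x 1 := by
  have : ProperSpace E := FiniteDimensional.proper ℝ E
  have : CompleteSpace E := FiniteDimensional.complete ℝ E
  obtain ⟨B, hB0, hB⟩ := exists_norm_le_of_isCompact
    ((isCompact_Icc (a := 0) (b := T + 1)).prod (isCompact_closedBall (0 : E) (ρ + 1)))
    hR.continuous
  obtain ⟨L, hL⟩ := exists_lipschitzOnWith_closedBall hR 0 (T + 1) (ρ + 1)
  -- At speed at most `B`, a solution cannot leave the unit ball before time `B⁻¹`.
  refine ⟨min 1 B⁻¹, by positivity, min_le_left _ _, fun t ht x hx => ?_⟩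
  set h₀ := min 1 B⁻¹
  have hh0 : 0 < h₀ := by positivity
  have hh1 : h₀ ≤ 1 := min_le_left _ _
  have hball : Metric.closedBall x 1 ⊆ Metric.closedBall (0 : E) (ρ + 1) :=
    Metric.closedBall_subset_closedBall' (by rw [dist_zero_right]; linarith)
  have htime : Icc t (t + h₀) ⊆ Icc 0 (T + 1) := Icc_subset_Icc ht.1 (by linarith [ht.2])
  have hPL : IsPicardLindelof R (tmin := t) (tmax := t + h₀) ⟨t, le_rfl, by linarith⟩ x 1 0
      ⟨B, hB0.le⟩ L := by
    refine ⟨fun u hu => (hL u (htime hu)).mono (by simpa using hball), fun y _ => ?_,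
      fun u hu y hy => hB (u, y) ⟨htime hu, hball (by simpa using hy)⟩, ?_⟩
    · exact (hR.continuous.comp (continuous_id.prodMk continuous_const)).continuousOn
    · have h3 : B * h₀ ≤ 1 := by
        calc B * h₀ ≤ B * B⁻¹ := by gcongr; exact min_le_right _ _
          _ = 1 := mul_inv_cancel₀ hB0.ne'
      change B * max (t + h₀ - t) (t - t) ≤ 1 - 0
      rwa [add_sub_cancel_left, sub_self, max_eq_left hh0.le, sub_zero]
  exact hPL.exists_solution_mem_closedBall (Metric.mem_closedBall_self le_rfl)

/-- Two solutions with values in a set where the field is `L`-Lipschitz separate at most at rate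
`exp (L * h)`. -/
theorem IsSolutionOn.norm_sub_le {R : ℝ → E → E} {y z : ℝ → E} {t h : ℝ} (hh : 0 ≤ h) {S : Set E}
    {L : NNReal} (hL : ∀ u ∈ Icc t (t + h), LipschitzOnWith L (R u) S)
    (hy : IsSolutionOn R y t (t + h)) (hz : IsSolutionOn R z t (t + h))
    (hyS : ∀ u ∈ Icc t (t + h), y u ∈ S) (hzS : ∀ u ∈ Icc t (t + h), z u ∈ S) :
    ‖y (t + h) - z (t + h)‖ ≤ ‖y t - z t‖ * Real.exp (L * h) := by
  have := dist_le_of_trajectories_ODE_of_mem (s := fun _ => S)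
    (fun u hu => hL u (Ico_subset_Icc_self hu))
    (fun u hu => (hy u hu).continuousWithinAt)
    (fun u hu => (hy u (Ico_subset_Icc_self hu)).mono_of_mem_nhdsWithin (Icc_mem_nhdsGE_of_mem hu))
    (fun u hu => hyS u (Ico_subset_Icc_self hu))
    (fun u hu => (hz u hu).continuousWithinAt)
    (fun u hu => (hz u (Ico_subset_Icc_self hu)).mono_of_mem_nhdsWithin (Icc_mem_nhdsGE_of_mem hu))
    (fun u hu => hzS u (Ico_subset_Icc_self hu)) le_rfl (t + h) ⟨by linarith, le_rfl⟩
  simpa [dist_eq_norm] using this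

end Analysis

/-! ### Runge-Kutta maps: linear naturality, smoothness, uniform local error -/

namespace ExplicitRK

variable {s : ℕ} (M : ExplicitRK s)

section Linear

variable {E F : Type*} [AddCommGroup E] [Module ℝ E] [AddCommGroup F] [Module ℝ F]

/-- Runge-Kutta stages commute with linear maps intertwining two systems. -/
theorem map_stageDeriv {R : ℝ → E → E} {R' : ℝ → F → F} (π : E →ₗ[ℝ] F)
    (hπ : ∀ t x, π (R t x) = R' t (π x)) (t : ℝ) (x : E) (h : ℝ) (i : Fin s) :
    π (M.stageDeriv R t x h i) = M.stageDeriv R' t (π x) h i := by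
  induction i using WellFoundedLT.induction with
  | ind i ih =>
    rw [stageDeriv, stageDeriv, hπ, map_add, map_smul, map_sum]
    congr 3
    exact Finset.sum_congr rfl fun j _ => by rw [map_smul, ih j.1 j.2]

theorem map_stageValue {R : ℝ → E → E} {R' : ℝ → F → F} (π : E →ₗ[ℝ] F)
    (hπ : ∀ t x, π (R t x) = R' t (π x)) (t : ℝ) (x : E) (h : ℝ) (i : Fin s) :
    π (M.stageValue R t x h i) = M.stageValue R' t (π x) h i := by
  simp only [stageValue, map_add, map_smul, map_sum, M.map_stageDeriv π hπ]

theorem map_step {R : ℝ → E → E} {R' : ℝ → F → F} (π : E →ₗ[ℝ] F)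
    (hπ : ∀ t x, π (R t x) = R' t (π x)) (t : ℝ) (x : E) (h : ℝ) :
    π (M.step R t x h) = M.step R' t (π x) h := by
  simp only [step, map_add, map_smul, map_sum, M.map_stageDeriv π hπ]

end Linear

section Smooth

variable {E : Type*} [NormedAddCommGroup E] [NormedSpace ℝ E]

theorem contDiff_stageDeriv {R : ℝ → E → E} (hR : ContDiff ℝ ∞ fun z : ℝ × E => R z.1 z.2)
    (i : Fin s) : ContDiff ℝ ∞ fun w : ℝ × E × ℝ => M.stageDeriv R w.1 w.2.1 w.2.2 i := by
  induction i using WellFoundedLT.induction with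
  | ind i ih =>
    have h1 : ContDiff ℝ ∞ fun w : ℝ × E × ℝ =>
        ∑ j : {j : Fin s // j < i}, M.a i j.1 • M.stageDeriv R w.1 w.2.1 w.2.2 j.1 :=
      ContDiff.sum fun j _ => contDiff_const.smul (ih j.1 j.2)
    have h2 : ContDiff ℝ ∞ fun w : ℝ × E × ℝ => (w.1 + M.c i * w.2.2, w.2.1 + w.2.2 •
        ∑ j : {j : Fin s // j < i}, M.a i j.1 • M.stageDeriv R w.1 w.2.1 w.2.2 j.1) := by
      fun_prop
    have h3 := hR.comp h2
    convert h3 using 2 with w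
    rw [stageDeriv]
    rfl

theorem contDiff_step {R : ℝ → E → E} (hR : ContDiff ℝ ∞ fun z : ℝ × E => R z.1 z.2) :
    ContDiff ℝ ∞ fun w : ℝ × E × ℝ => M.step R w.1 w.2.1 w.2.2 := by
  have h1 : ContDiff ℝ ∞ fun w : ℝ × E × ℝ =>
      ∑ j, M.b j • M.stageDeriv R w.1 w.2.1 w.2.2 j :=
    ContDiff.sum fun j _ => contDiff_const.smul (M.contDiff_stageDeriv hR j)
  unfold step
  fun_prop

variable {M}

/-- The order condition holds for systems in any finite-dimensional normed space. -/
theorem HasOrder.isBigO [FiniteDimensional ℝ E] {p : ℕ} (hM : M.HasOrder p) {R : ℝ → E → E}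
    (hR : ContDiff ℝ ∞ fun z : ℝ × E => R z.1 z.2) {t₀ t₁ : ℝ} {y : ℝ → E} (ht : t₀ < t₁)
    (hy : IsSolutionOn R y t₀ t₁) :
    (fun h : ℝ => y (t₀ + h) - M.step R t₀ (y t₀) h) =O[𝓝[>] 0] fun h : ℝ => h ^ (p + 1) := by
  have e := toEuclidean (E := E)
  -- The order hypothesis concerns Euclidean spaces. The method commutes with conjugation by a
  -- linear isomorphism, which changes errors by a bounded factor only.
  have key := hM _ (fun t x => e (R t (e.symm x)))
    (e.contDiff.comp (hR.comp (contDiff_fst.prodMk (e.symm.contDiff.comp contDiff_snd))))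
    t₀ t₁ (fun t => e (y t)) ht fun t htm => by
      have h1 : HasDerivWithinAt (fun t => e (y t)) (e (R t (y t))) (Icc t₀ t₁) t :=
        e.hasFDerivAt.comp_hasDerivWithinAt t (hy t htm)
      simpa using h1
  have h2 := (e.symm.toContinuousLinearMap.isBigO_comp _ (𝓝[>] (0 : ℝ))).trans key
  refine h2.congr_left fun h => ?_
  have h3 := M.map_step (R := R) (R' := fun t x => e (R t (e.symm x)))
    (e.toLinearEquiv : E →ₗ[ℝ] _) (fun t x => by simp) t₀ (y t₀) h
  simp only [LinearEquiv.coe_coe, ContinuousLinearEquiv.coe_toLinearEquiv] at h3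
  simp [← h3]

/-- A method of positive order has at least one stage. -/
theorem HasOrder.stages_pos {p : ℕ} (hp : 1 ≤ p) (hM : M.HasOrder p) : 0 < s := by
  by_contra hs
  obtain rfl : s = 0 := by omega
  -- Without stages the method stands still, so for `y' = 1` the local error is exactly `h`, which
  -- is not `O(h ^ 2)`.
  have h1 := hM.isBigO (R := fun _ _ : ℝ => (1 : ℝ)) contDiff_const one_pos (y := id)
    fun t _ => hasDerivWithinAt_id t _
  have h2 : (fun h : ℝ => ∑ k ∈ Finset.range 2, h ^ k • (if k = 1 then (1 : ℝ) else 0))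
      =O[𝓝[>] 0] fun h : ℝ => h ^ 2 := by
    refine (h1.congr_left fun h => ?_).trans (IsBigO.of_bound 1 ?_)
    · simp [step]
    · filter_upwards [Ioc_mem_nhdsGT one_pos] with h hh
      rw [one_mul, norm_pow, norm_pow, Real.norm_of_nonneg hh.1.le]
      exact pow_le_pow_of_le_one hh.1.le hh.2 (by omega)
  simpa using coeff_eq_zero_of_isBigO h2 1 (by norm_num)

/-- The local error of a method of order `p` is bounded by `C * h ^ (p + 1)`, with a constant that
is uniform over bounded sets of initial data. -/
theorem HasOrder.exists_uniform_localError [FiniteDimensional ℝ E] {p : ℕ} (hM : M.HasOrder p)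
    {R : ℝ → E → E} (hR : ContDiff ℝ ∞ fun z : ℝ × E => R z.1 z.2) (T ρ : ℝ) :
    ∃ h₀ C : ℝ, 0 < h₀ ∧ h₀ ≤ 1 ∧ 0 < C ∧ ∀ t ∈ Icc 0 T, ∀ x : E, ‖x‖ ≤ ρ →
      ∃ z : ℝ → E, z t = x ∧ IsSolutionOn R z t (t + h₀) ∧
        (∀ u, z u ∈ Metric.closedBall x 1) ∧
        ∀ h ∈ Icc 0 h₀, ‖z (t + h) - M.step R t x h‖ ≤ C * h ^ (p + 1) := by
  have : ProperSpace E := FiniteDimensional.proper ℝ E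
  obtain ⟨h₀, hh0, hh1, hz⟩ := exists_isSolutionOn_uniform hR T ρ
  -- The coordinates are elapsed time, initial time, initial point and current point. The local
  -- error is the fixed smooth function `Φ` along an integral curve of `v`, so its derivatives in
  -- `h` are iterated derivatives along `v`, bounded on a compact set independent of the initial
  -- data.
  let v : ℝ × ℝ × E × E → ℝ × ℝ × E × E := fun w => (1, 0, 0, R (w.2.1 + w.1) w.2.2.2)
  let Φ : ℝ × ℝ × E × E → E := fun w => w.2.2.2 - M.step R w.2.1 w.2.2.1 w.1
  have hv : ContDiff ℝ ∞ v := by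
    refine contDiff_const.prodMk (contDiff_const.prodMk (contDiff_const.prodMk ?_))
    have h2 : ContDiff ℝ ∞ fun w : ℝ × ℝ × E × E => (w.2.1 + w.1, w.2.2.2) := by fun_prop
    exact hR.comp h2
  have hΦ : ContDiff ℝ ∞ Φ := by
    have h2 : ContDiff ℝ ∞ fun w : ℝ × ℝ × E × E => (w.2.1, w.2.2.1, w.1) := by fun_prop
    have h3 : ContDiff ℝ ∞ fun w : ℝ × ℝ × E × E => w.2.2.2 := by fun_prop
    exact h3.sub ((M.contDiff_step hR).comp h2)
  obtain ⟨C, hC0, hC⟩ := exists_norm_le_of_isCompact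
    ((isCompact_Icc (a := (0 : ℝ)) (b := 1)).prod ((isCompact_Icc (a := 0) (b := T)).prod
      ((isCompact_closedBall (0 : E) ρ).prod (isCompact_closedBall (0 : E) (ρ + 1)))))
    (contDiff_iterDerivAlong hv hΦ (p + 1)).continuous
  refine ⟨h₀, C, hh0, hh1, hC0, fun t ht x hx => ?_⟩
  obtain ⟨z, hzt, hzs, hzb⟩ := hz t ht x hx
  refine ⟨z, hzt, hzs, hzb, fun h hh => ?_⟩
  let γ : ℝ → ℝ × ℝ × E × E := fun u => (u, t, x, z (t + u))
  have hγ : ∀ u ∈ Icc 0 h₀, HasDerivWithinAt γ (v (γ u)) (Icc 0 h₀) u := by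
    intro u hu
    have hz' : HasDerivWithinAt (fun u => z (t + u)) (R (t + u) (z (t + u))) (Icc 0 h₀) u := by
      have h1 := hzs (t + u) ⟨by linarith [hu.1], by linarith [hu.2]⟩
      have h2 : HasDerivWithinAt (fun u => t + u) 1 (Icc 0 h₀) u :=
        (hasDerivWithinAt_id u _).const_add t
      have h3 := h1.scomp u h2 fun w hw => ⟨by linarith [hw.1], by linarith [hw.2]⟩
      rw [one_smul] at h3
      exact h3
    exact (hasDerivWithinAt_id u _).prodMk ((hasDerivWithinAt_const u _ t).prodMk
      ((hasDerivWithinAt_const u _ x).prodMk hz'))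
  refine norm_le_of_isBigO_of_deriv_bound (e := fun k u => iterDerivAlong v Φ k (γ u)) hh0
    (fun k _ u hu => hasDerivWithinAt_iterDerivAlong hv hΦ k (hγ u hu)) (fun u hu => ?_) ?_ hh
  · refine hC _ ⟨⟨hu.1, hu.2.trans hh1⟩, ht, by simpa using hx, ?_⟩
    exact Metric.closedBall_subset_closedBall' (by rw [dist_zero_right]; linarith) (hzb _)
  · have := hM.isBigO hR (by linarith) hzs
    rwa [hzt] at this

end Smooth

/-! ### The target value as a component of an enlarged Runge-Kutta step -/

section Gradient

variable {m : ℕ} {M}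

theorem inner_gradient {G : EuclideanSpace ℝ (Fin m) → ℝ} (x v : EuclideanSpace ℝ (Fin m)) :
    inner ℝ (gradient G x) v = fderiv ℝ G x v := by
  rw [gradient, InnerProductSpace.toDual_symm_apply]

/-- Along a method of order `p`, the update and the target value of the projection equation are
both accurate to `O(h ^ (p + 1))`, uniformly over bounded sets. -/
theorem HasOrder.exists_uniform_localError_target {p : ℕ} (hM : M.HasOrder p)
    {R : ℝ → EuclideanSpace ℝ (Fin m) → EuclideanSpace ℝ (Fin m)}
    (hR : ContDiff ℝ ∞ fun z : ℝ × EuclideanSpace ℝ (Fin m) => R z.1 z.2)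
    {G : EuclideanSpace ℝ (Fin m) → ℝ} (hG : ContDiff ℝ ∞ G) (T ρ : ℝ) :
    ∃ h₀ C : ℝ, 0 < h₀ ∧ h₀ ≤ 1 ∧ 0 < C ∧
      ∀ t ∈ Icc 0 T, ∀ x : EuclideanSpace ℝ (Fin m), ‖x‖ ≤ ρ →
      ∃ z : ℝ → EuclideanSpace ℝ (Fin m), z t = x ∧ IsSolutionOn R z t (t + h₀) ∧
        (∀ u, z u ∈ Metric.closedBall x 1) ∧
        ∀ h ∈ Icc 0 h₀, ‖z (t + h) - M.step R t x h‖ ≤ C * h ^ (p + 1) ∧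
          |G (z (t + h)) - M.target R G t x h| ≤ C * h ^ (p + 1) := by
  let S : ℝ → EuclideanSpace ℝ (Fin m) × ℝ → EuclideanSpace ℝ (Fin m) × ℝ :=
    fun t y => (R t y.1, fderiv ℝ G y.1 (R t y.1))
  have hS : ContDiff ℝ ∞ fun z : ℝ × EuclideanSpace ℝ (Fin m) × ℝ => S z.1 z.2 := by
    have h2 : ContDiff ℝ ∞ fun z : ℝ × EuclideanSpace ℝ (Fin m) × ℝ => (z.1, z.2.1) := by fun_prop
    have h3 : ContDiff ℝ ∞ fun z : ℝ × EuclideanSpace ℝ (Fin m) × ℝ => R z.1 z.2.1 := hR.comp h2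
    have h4 : ContDiff ℝ ∞ fun z : ℝ × EuclideanSpace ℝ (Fin m) × ℝ => z.2.1 := by fun_prop
    exact h3.prodMk (((hG.fderiv_right (m := ∞) (by simp)).comp h4).clm_apply h3)
  obtain ⟨B, hB0, hB⟩ := exists_norm_le_of_isCompact
    (isCompact_closedBall (0 : EuclideanSpace ℝ (Fin m)) ρ) hG.continuous
  -- The product carries the sup norm, so `max ρ B` bounds the initial pair `(x, G x)`.
  obtain ⟨h₀, C, hh0, hh1, hC0, H⟩ := hM.exists_uniform_localError hS T (max ρ B)
  refine ⟨h₀, C, hh0, hh1, hC0, fun t ht x hx => ?_⟩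
  obtain ⟨z, hzt, hzs, hzb, hze⟩ := H t ht (x, G x) (by
    rw [Prod.norm_def]
    exact max_le_max hx (hB x (by simpa using hx)))
  have hz1 : IsSolutionOn R (fun u => (z u).1) t (t + h₀) := fun u hu =>
    (ContinuousLinearMap.fst ℝ (EuclideanSpace ℝ (Fin m)) ℝ).hasFDerivAt.comp_hasDerivWithinAt u
      (hzs u hu)
  have hz2 : ∀ u ∈ Icc t (t + h₀), HasDerivWithinAt (fun u => (z u).2)
      (fderiv ℝ G (z u).1 (R u (z u).1)) (Icc t (t + h₀)) u := fun u hu =>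
    (ContinuousLinearMap.snd ℝ (EuclideanSpace ℝ (Fin m)) ℝ).hasFDerivAt.comp_hasDerivWithinAt u
      (hzs u hu)
  have hGz : ∀ u ∈ Icc t (t + h₀), (z u).2 = G (z u).1 := by
    intro u hu
    have hd : ∀ u ∈ Icc t (t + h₀), HasDerivWithinAt (fun u => (z u).2 - G (z u).1) 0
        (Icc t (t + h₀)) u := fun u hu => by
      have h1 := (hz2 u hu).sub ((hG.differentiable (by simp)
        (z u).1).hasFDerivAt.comp_hasDerivWithinAt u (hz1 u hu))
      rw [sub_self] at h1
      exact h1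
    have := norm_image_sub_le_of_norm_deriv_le_segment' (C := 0) hd (by simp) u hu
    rw [zero_mul, norm_le_zero_iff, hzt, sub_self, sub_zero] at this
    exact sub_eq_zero.1 this
  refine ⟨fun u => (z u).1, by simp [hzt], hz1, fun u => ?_, fun h hh => ?_⟩
  · have := hzb u
    rw [Metric.mem_closedBall, Prod.dist_eq] at this
    exact (le_max_left _ _).trans this
  have hfst : ∀ (t : ℝ) (y : EuclideanSpace ℝ (Fin m) × ℝ),
      LinearMap.fst ℝ _ _ (S t y) = R t (LinearMap.fst ℝ _ _ y) := fun _ _ => rfl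
  have hs1 : (M.step S t (x, G x) h).1 = M.step R t x h :=
    M.map_step (LinearMap.fst ℝ (EuclideanSpace ℝ (Fin m)) ℝ) hfst t (x, G x) h
  have hs2 : (M.step S t (x, G x) h).2 = M.target R G t x h := by
    -- `S` ignores the scalar component, so the scalar stage derivatives only see the stage values
    -- of the original system.
    have hd : ∀ i, (M.stageDeriv S t (x, G x) h i).2
        = inner ℝ (gradient G (M.stageValue R t x h i)) (M.stageDeriv R t x h i) := by
      intro i
      have hv : (M.stageValue S t (x, G x) h i).1 = M.stageValue R t x h i :=
        M.map_stageValue (LinearMap.fst ℝ (EuclideanSpace ℝ (Fin m)) ℝ) hfst t (x, G x) h i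
      rw [inner_gradient, M.stageDeriv_eq S, M.stageDeriv_eq R, ← hv]
    simp only [step, target, Prod.snd_add, Prod.smul_snd, Prod.snd_sum, hd, smul_eq_mul]
  have he := hze h hh
  rw [Prod.norm_def] at he
  refine ⟨?_, ?_⟩
  · rw [← hs1]
    exact (le_max_left _ _).trans he
  · rw [← hs2, ← hGz (t + h) ⟨by linarith [hh.1], by linarith [hh.2]⟩]
    exact (le_max_right _ _).trans he

end Gradient

end ExplicitRK

/-! ### Solvability of the projection equation -/

/-- A scalar equation whose left-hand side has derivative at least `c > 0` on `[-ρ, ρ]` has exactly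
one solution there if its residual at `0` is at most `c * ρ`. -/
theorem existsUnique_of_le_deriv {φ φ' : ℝ → ℝ} {ρ c τ η : ℝ} (hρ : 0 < ρ) (hc : 0 < c)
    (hφ : ∀ l, HasDerivAt φ (φ' l) l) (hφ' : ∀ l, |l| ≤ ρ → c ≤ φ' l)
    (hτ : |τ - φ 0| ≤ η) (hη : η ≤ c * ρ) :
    (∃! l, |l| ≤ ρ ∧ φ l = τ) ∧ ∀ l, |l| ≤ ρ → φ l = τ → |l| ≤ η / c := by
  have hcont : ContinuousOn φ (Icc (-ρ) ρ) := fun l _ => (hφ l).continuousAt.continuousWithinAt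
  have hmono : ∀ a b, |a| ≤ ρ → |b| ≤ ρ → a ≤ b → c * (b - a) ≤ φ b - φ a := fun a b ha hb hab =>
    (convex_Icc (-ρ) ρ).mul_sub_le_image_sub_of_le_deriv hcont
      (fun l _ => (hφ l).differentiableAt.differentiableWithinAt)
      (fun l hl => by
        rw [(hφ l).deriv]
        have hl' : l ∈ Icc (-ρ) ρ := interior_subset hl
        exact hφ' l (abs_le.2 hl')) a (abs_le.1 ha) b (abs_le.1 hb) hab
  have habs : ∀ a b, |a| ≤ ρ → |b| ≤ ρ → c * |b - a| ≤ |φ b - φ a| := by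
    intro a b ha hb
    rcases le_total a b with hab | hab
    · rw [abs_of_nonneg (sub_nonneg.2 hab)]
      exact (hmono a b ha hb hab).trans (le_abs_self _)
    · rw [abs_sub_comm b a, abs_sub_comm (φ b), abs_of_nonneg (sub_nonneg.2 hab)]
      exact (hmono b a hb ha hab).trans (le_abs_self _)
  have h0 : |(0 : ℝ)| ≤ ρ := by simpa using hρ.le
  have hρ1 : |ρ| ≤ ρ := (abs_of_pos hρ).le
  have hρ2 : |-ρ| ≤ ρ := by rwa [abs_neg]
  have hu := hmono 0 ρ h0 hρ1 hρ.le
  have hl := hmono (-ρ) 0 hρ2 h0 (by linarith)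
  obtain ⟨hτ1, hτ2⟩ := abs_le.1 hτ
  obtain ⟨l, hl1, hl2⟩ := intermediate_value_Icc (by linarith) hcont
    (show τ ∈ Icc (φ (-ρ)) (φ ρ) from ⟨by linarith, by linarith⟩)
  refine ⟨⟨l, ⟨abs_le.2 hl1, hl2⟩, fun k ⟨hk1, hk2⟩ => ?_⟩, fun k hk1 hk2 => ?_⟩
  · have := habs l k (abs_le.2 hl1) hk1
    rw [hk2, hl2, sub_self, abs_zero] at this
    have h2 : |k - l| ≤ 0 := nonpos_of_mul_nonpos_right this hc
    exact sub_eq_zero.1 (abs_nonpos_iff.1 h2)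
  · have := habs 0 k h0 hk1
    rw [hk2, sub_zero] at this
    rw [le_div_iff₀ hc, mul_comm]
    exact this.trans hτ

/-- Solvability of the projection equation along the projection of the gradient onto a subspace
containing a direction `v` of definite descent. -/
theorem existsUnique_projection {E : Type*} [NormedAddCommGroup E] [InnerProductSpace ℝ E]
    [CompleteSpace E] {G : E → ℝ} (hG : Differentiable ℝ G) (S : Submodule ℝ E)
    [S.HasOrthogonalProjection] {y v : E} {B δ Lg ρ τ η : ℝ} (hB : 0 < B) (hδ : 0 < δ)
    (hρ : 0 < ρ) (hLg : 0 ≤ Lg) (hv : v ∈ S) (hvB : ‖v‖ ≤ B) (hyv : fderiv ℝ G y v ≤ -δ)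
    (hLip : ∀ w, ‖w - y‖ ≤ ρ → ‖fderiv ℝ G w - fderiv ℝ G y‖ ≤ Lg * ‖w - y‖)
    (hLρ : Lg * ρ ≤ δ / (2 * B)) (hτ : |τ - G y| ≤ η) (hη : η ≤ δ / (2 * B) * ρ) :
    let P := S.starProjection (gradient G y)
    P ≠ 0 ∧ (∃! l, |l| ≤ ρ ∧ G (y + l • (‖P‖⁻¹ • P)) = τ) ∧
      ∀ l, |l| ≤ ρ → G (y + l • (‖P‖⁻¹ • P)) = τ →
        ‖y + l • (‖P‖⁻¹ • P) - y‖ ≤ η / (δ / (2 * B)) := by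
  intro P
  have hgrad : ∀ w, inner ℝ (gradient G y) w = fderiv ℝ G y w := fun w => by
    rw [gradient, InnerProductSpace.toDual_symm_apply]
  have hPS : ∀ w ∈ S, inner ℝ P w = fderiv ℝ G y w := fun w hw => by
    rw [← hgrad, Submodule.inner_starProjection_left_eq_right,
      Submodule.starProjection_eq_self_iff.2 hw]
  -- On `S` the projected gradient represents the differential, so descent along `v ∈ S` forces `P`
  -- to be large.
  have hPv : δ ≤ ‖P‖ * B := by
    have h1 := abs_real_inner_le_norm P v
    rw [hPS v hv] at h1
    calc δ ≤ |fderiv ℝ G y v| := by rw [abs_of_nonpos (by linarith)]; linarith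
      _ ≤ ‖P‖ * ‖v‖ := h1
      _ ≤ ‖P‖ * B := by gcongr
  have hPpos : 0 < ‖P‖ := by
    by_contra hcon
    have : ‖P‖ * B ≤ 0 := mul_nonpos_of_nonpos_of_nonneg (not_lt.1 hcon) hB.le
    linarith
  have hP0 : P ≠ 0 := norm_pos_iff.1 hPpos
  have hc : 0 < δ / (2 * B) := by positivity
  -- The slope at `l = 0` equals `‖P‖`, twice the slope required; the other half absorbs the
  -- variation of the differential over `|l| ≤ ρ`.
  have hPc : 2 * (δ / (2 * B)) ≤ ‖P‖ := by
    have : 2 * (δ / (2 * B)) = δ / B := by field_simp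
    rw [this, div_le_iff₀ hB]
    exact hPv
  set e := ‖P‖⁻¹ • P with he
  have hen : ‖e‖ = 1 := by
    rw [he, norm_smul, norm_inv, norm_norm, inv_mul_cancel₀ hPpos.ne']
  have hye : fderiv ℝ G y e = ‖P‖ := by
    rw [he, map_smul, ← hPS P (Submodule.starProjection_apply_mem _ _),
      real_inner_self_eq_norm_sq, smul_eq_mul]
    field_simp
  have hle : ∀ l : ℝ, ‖y + l • e - y‖ = |l| := fun l => by
    rw [add_sub_cancel_left, norm_smul, hen, mul_one, Real.norm_eq_abs]
  have hder : ∀ l : ℝ, HasDerivAt (fun l : ℝ => G (y + l • e)) (fderiv ℝ G (y + l • e) e) l := by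
    intro l
    have h1 : HasDerivAt (fun l : ℝ => y + l • e) e l := by
      simpa using ((hasDerivAt_id l).smul_const e).const_add y
    exact (hG (y + l • e)).hasFDerivAt.comp_hasDerivAt l h1
  have hslope : ∀ l : ℝ, |l| ≤ ρ → δ / (2 * B) ≤ fderiv ℝ G (y + l • e) e := by
    intro l hl
    have h1 := hLip (y + l • e) ((hle l).trans_le hl)
    rw [hle] at h1
    have h2 : |fderiv ℝ G (y + l • e) e - fderiv ℝ G y e| ≤ δ / (2 * B) := by
      calc |fderiv ℝ G (y + l • e) e - fderiv ℝ G y e|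
          = ‖(fderiv ℝ G (y + l • e) - fderiv ℝ G y) e‖ := rfl
        _ ≤ ‖fderiv ℝ G (y + l • e) - fderiv ℝ G y‖ * ‖e‖ := ContinuousLinearMap.le_opNorm _ _
        _ ≤ Lg * ρ := by
          rw [hen, mul_one]
          exact h1.trans (mul_le_mul_of_nonneg_left hl hLg)
        _ ≤ _ := hLρ
    have := (abs_le.1 h2).1
    rw [hye] at this
    linarith
  obtain ⟨h1, h2⟩ := existsUnique_of_le_deriv (φ := fun l : ℝ => G (y + l • e)) (τ := τ)
    hρ hc hder hslope (by simpa using hτ) hη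
  exact ⟨hP0, h1, fun l hl1 hl2 => (hle l).trans_le (h2 l hl1 hl2)⟩

theorem IsSolutionOn.mono {E : Type*} [NormedAddCommGroup E] [NormedSpace ℝ E] {R : ℝ → E → E}
    {y : ℝ → E} {a b a' b' : ℝ} (hy : IsSolutionOn R y a b) (ha : a ≤ a') (hb : b' ≤ b) :
    IsSolutionOn R y a' b' := fun t ht =>
  (hy t (Icc_subset_Icc ha hb ht)).mono (Icc_subset_Icc ha hb)

/-! ### One projection step near the exact solution -/

namespace ExplicitRK

variable {s m p : ℕ} {M : ExplicitRK s}

/-- The first stage derivative of an explicit method is the value of the field. -/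
theorem stageDeriv_zero {E : Type*} [AddCommGroup E] [Module ℝ E] (M : ExplicitRK s) (hs : 0 < s)
    (R : ℝ → E → E) (t : ℝ) (x : E) (h : ℝ) : M.stageDeriv R t x h ⟨0, hs⟩ = R t x := by
  have ha : ∀ j, M.a ⟨0, hs⟩ j = 0 := fun j => M.explicit _ _ (Nat.zero_le _)
  rw [stageDeriv_eq]
  simp [c, stageValue, ha]

/-- The update moves the initial point by `O(h)`, uniformly over bounded sets. -/
theorem exists_norm_step_sub_le {E : Type*} [NormedAddCommGroup E] [NormedSpace ℝ E]
    [FiniteDimensional ℝ E] (M : ExplicitRK s) {R : ℝ → E → E}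
    (hR : ContDiff ℝ ∞ fun z : ℝ × E => R z.1 z.2) (T ρ : ℝ) :
    ∃ A : ℝ, 0 < A ∧ ∀ t ∈ Icc 0 T, ∀ x : E, ‖x‖ ≤ ρ → ∀ h ∈ Icc (0 : ℝ) 1,
      ‖M.step R t x h - x‖ ≤ A * h := by
  have : ProperSpace E := FiniteDimensional.proper ℝ E
  obtain ⟨A, hA0, hA⟩ := exists_norm_le_of_isCompact
    ((isCompact_Icc (a := 0) (b := T)).prod ((isCompact_closedBall (0 : E) ρ).prod
      (isCompact_Icc (a := (0 : ℝ)) (b := 1))))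
    (Φ := fun w : ℝ × E × ℝ => ∑ j, M.b j • M.stageDeriv R w.1 w.2.1 w.2.2 j)
    (continuous_finsetSum _ fun j _ => continuous_const.smul (M.contDiff_stageDeriv hR j).continuous)
  refine ⟨A, hA0, fun t ht x hx h hh => ?_⟩
  rw [step, add_sub_cancel_left, norm_smul, Real.norm_of_nonneg hh.1, mul_comm]
  exact mul_le_mul_of_nonneg_right (hA (t, x, h) ⟨ht, by simpa using hx, hh⟩) hh.1

/-- Dissipation persists in a neighbourhood of the solution curve. -/
theorem exists_tube_dissipative {R : ℝ → EuclideanSpace ℝ (Fin m) → EuclideanSpace ℝ (Fin m)}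
    (hR : ContDiff ℝ ∞ fun z : ℝ × EuclideanSpace ℝ (Fin m) => R z.1 z.2)
    {G : EuclideanSpace ℝ (Fin m) → ℝ} (hG : ContDiff ℝ ∞ G) {T : ℝ} (hT : 0 ≤ T)
    {q : ℝ → EuclideanSpace ℝ (Fin m)} (hq : ContinuousOn q (Icc 0 T))
    (hdiss : ∀ t ∈ Icc 0 T, inner ℝ (gradient G (q t)) (R t (q t)) < 0) :
    ∃ r δ : ℝ, 0 < r ∧ r ≤ 1 ∧ 0 < δ ∧ ∀ t ∈ Icc 0 T, ∀ x, ‖x - q t‖ ≤ r →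
      fderiv ℝ G x (R t x) ≤ -δ := by
  have hg : ContDiff ℝ ∞ fun z : ℝ × EuclideanSpace ℝ (Fin m) => fderiv ℝ G z.2 (R z.1 z.2) :=
    ((hG.fderiv_right (m := ∞) (by simp)).comp contDiff_snd).clm_apply hR
  obtain ⟨t₀, ht₀, hmax⟩ := isCompact_Icc.exists_isMaxOn ⟨0, ⟨le_rfl, hT⟩⟩
    (hg.continuous.comp_continuousOn (continuousOn_id.prodMk hq))
  -- Half of the slowest dissipation rate on the curve; the other half is lost in moving off the
  -- curve by at most `δ / (L + 1)`.
  set δ := -(fderiv ℝ G (q t₀) (R t₀ (q t₀))) / 2 with hδ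
  have hδ0 : 0 < δ := by
    have := hdiss t₀ ht₀
    rw [inner_gradient] at this
    linarith
  obtain ⟨M0, hM0⟩ := isCompact_Icc.exists_bound_of_continuousOn hq
  obtain ⟨L, hL⟩ := exists_lipschitzOnWith_closedBall
    (Φ := fun t x => fderiv ℝ G x (R t x)) hg 0 T (M0 + 1)
  have hLr : (L : ℝ) * (δ / (L + 1)) ≤ δ := by
    rw [mul_div_assoc', div_le_iff₀ (by positivity)]
    nlinarith [L.coe_nonneg]
  refine ⟨min 1 (δ / (L + 1)), δ, by positivity, min_le_left _ _, hδ0, fun t ht x hx => ?_⟩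
  have h1 := (hL t ht).norm_sub_le (x := x) (y := q t)
    (by
      rw [mem_closedBall_zero_iff]
      have := norm_le_norm_add_norm_sub' x (q t)
      linarith [hM0 t ht, hx.trans (min_le_left _ _)])
    (by
      rw [mem_closedBall_zero_iff]
      linarith [hM0 t ht])
  have h2 : (L : ℝ) * ‖x - q t‖ ≤ δ :=
    (mul_le_mul_of_nonneg_left (hx.trans (min_le_right _ _)) L.coe_nonneg).trans hLr
  have h3 := (le_abs_self _).trans (h1.trans h2)
  have h4 : fderiv ℝ G (q t) (R t (q t)) ≤ fderiv ℝ G (q t₀) (R t₀ (q t₀)) := hmax ht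
  linarith

/-- One step of the quasi-orthogonal projection method from points close to the exact solution. -/
theorem HasOrder.exists_projection_step (hp : 1 ≤ p) (hM : M.HasOrder p)
    {R : ℝ → EuclideanSpace ℝ (Fin m) → EuclideanSpace ℝ (Fin m)}
    (hR : ContDiff ℝ ∞ fun z : ℝ × EuclideanSpace ℝ (Fin m) => R z.1 z.2)
    {G : EuclideanSpace ℝ (Fin m) → ℝ} (hG : ContDiff ℝ ∞ G) {T : ℝ} (hT : 0 ≤ T)
    {q : ℝ → EuclideanSpace ℝ (Fin m)} (hq : IsSolutionOn R q 0 T)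
    (hdiss : ∀ t ∈ Icc 0 T, inner ℝ (gradient G (q t)) (R t (q t)) < 0) :
    ∃ hstar > 0, ∃ r > 0, ∃ ρ > 0, ∃ C > 0, ∃ L : NNReal, ∀ h : ℝ, 0 < h → h ≤ hstar →
      ∀ t ∈ Icc 0 T, ∀ x : EuclideanSpace ℝ (Fin m), ‖x - q t‖ ≤ r →
        M.gradS R G t x h ≠ 0 ∧
        (∃! lam : ℝ, |lam| ≤ ρ ∧ M.IsProjectionParam R G t x h lam) ∧
        ∃ z : ℝ → EuclideanSpace ℝ (Fin m), z t = x ∧ IsSolutionOn R z t (t + h) ∧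
          (∀ lam : ℝ, |lam| ≤ ρ → M.IsProjectionParam R G t x h lam →
            ‖M.projected R G t x h lam - z (t + h)‖ ≤ C * h ^ (p + 1)) ∧
          (t + h ≤ T → ‖z (t + h) - q (t + h)‖ ≤ ‖x - q t‖ * Real.exp (L * h)) := by
  have hs := hM.stages_pos hp
  have hqc : ContinuousOn q (Icc 0 T) := fun t ht => (hq t ht).continuousWithinAt
  have hdG : ContDiff ℝ ∞ (fderiv ℝ G) := hG.fderiv_right (by simp)
  obtain ⟨r, δ, hr0, hr1, hδ0, htube⟩ := exists_tube_dissipative hR hG hT hqc hdiss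
  obtain ⟨M0, hM0⟩ := isCompact_Icc.exists_bound_of_continuousOn hqc
  obtain ⟨h₀, C₀, hh0, hh1, hC0, Hloc⟩ := hM.exists_uniform_localError_target hR hG T (M0 + 1)
  -- Starting points have norm at most `M0 + 1`, the update and the local solution at most `M0 + 2`,
  -- and candidates within `ρ ≤ 1` of the update at most `M0 + 3`.
  obtain ⟨L, hL⟩ := exists_lipschitzOnWith_closedBall hR 0 T (M0 + 3)
  obtain ⟨LG, hLG⟩ := exists_lipschitzOnWith_closedBall (Φ := fun _ x => G x)
    (hG.comp contDiff_snd) 0 0 (M0 + 3)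
  obtain ⟨Lg, hLg⟩ := exists_lipschitzOnWith_closedBall (Φ := fun _ x => fderiv ℝ G x)
    (hdG.comp contDiff_snd) 0 0 (M0 + 3)
  obtain ⟨A, hA0, hA⟩ := M.exists_norm_step_sub_le hR T (M0 + 1)
  obtain ⟨B, hB0, hB⟩ := exists_norm_le_of_isCompact
    ((isCompact_Icc (a := 0) (b := T)).prod
      (isCompact_closedBall (0 : EuclideanSpace ℝ (Fin m)) (M0 + 1))) hR.continuous
  have hLG := hLG 0 ⟨le_rfl, le_rfl⟩
  have hLg := hLg 0 ⟨le_rfl, le_rfl⟩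
  -- The guaranteed slope of the scalar equation: the descent rate `δ` at `x` drops to no worse than
  -- `δ / 2` at the update.
  set κ : ℝ := δ / 2 / (2 * B) with hκ
  have hκ0 : 0 < κ := by positivity
  set ρ : ℝ := min 1 (κ / (Lg + 1)) with hρ
  have hρ0 : 0 < ρ := by positivity
  have hρ1 : ρ ≤ 1 := min_le_left _ _
  have hLρ : (Lg : ℝ) * ρ ≤ κ := by
    calc (Lg : ℝ) * ρ ≤ (Lg + 1) * (κ / (Lg + 1)) := by
          gcongr
          · linarith
          · exact min_le_right _ _
      _ = κ := by field_simp
  -- Residual at `lam = 0`: the error of the target plus the error of the update seen through `G`.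
  set C₁ : ℝ := C₀ + LG * C₀ with hC1
  have hC10 : 0 < C₁ := by positivity
  -- The four bounds on `h` ensure, in order, the local error estimate, an update within distance 1
  -- of `x`, descent at the update, and a residual at most `κ * ρ`.
  refine ⟨min (min h₀ A⁻¹) (min (δ / 2 / ((Lg + 1) * A * B)) (κ * ρ / C₁)), by positivity,
    r, hr0, ρ, hρ0, C₀ + C₁ / κ, by positivity, L, fun h hh hle t ht x hx => ?_⟩
  have hhh : h ≤ h₀ := hle.trans ((min_le_left _ _).trans (min_le_left _ _))
  have hhA : A * h ≤ 1 := by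
    have : h ≤ A⁻¹ := hle.trans ((min_le_left _ _).trans (min_le_right _ _))
    calc A * h ≤ A * A⁻¹ := by gcongr
      _ = 1 := mul_inv_cancel₀ hA0.ne'
  have hhδ : (Lg + 1) * A * B * h ≤ δ / 2 := by
    have : h ≤ δ / 2 / ((Lg + 1) * A * B) := hle.trans ((min_le_right _ _).trans (min_le_left _ _))
    rwa [le_div_iff₀ (by positivity), mul_comm] at this
  have hhC : C₁ * h ≤ κ * ρ := by
    have : h ≤ κ * ρ / C₁ := hle.trans ((min_le_right _ _).trans (min_le_right _ _))
    rwa [le_div_iff₀ hC10, mul_comm] at this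
  have hh1' : h ≤ 1 := hhh.trans hh1
  have hpow : h ^ (p + 1) ≤ h := by
    simpa using pow_le_pow_of_le_one hh.le hh1' (show 1 ≤ p + 1 by omega)
  have hxM : ‖x‖ ≤ M0 + 1 := by
    have := norm_le_norm_add_norm_sub' x (q t)
    linarith [hM0 t ht]
  obtain ⟨z, hzt, hzs, hzb, hze⟩ := Hloc t ht x hxM
  obtain ⟨hz1, hz2⟩ := hze h ⟨hh.le, hhh⟩
  set y := M.step R t x h with hy
  have hyx : ‖y - x‖ ≤ A * h := hA t ht x hxM h ⟨hh.le, hh1'⟩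
  have hyM : ‖y‖ ≤ M0 + 2 := by
    have := norm_le_norm_add_norm_sub' y x
    linarith
  have hball : ∀ {w : EuclideanSpace ℝ (Fin m)}, ‖w‖ ≤ M0 + 3 →
      w ∈ Metric.closedBall (0 : EuclideanSpace ℝ (Fin m)) (M0 + 3) := fun hw => by
    simpa using hw
  have hzM : ∀ u, ‖z u‖ ≤ M0 + 2 := fun u => by
    have h1 := hzb u
    rw [mem_closedBall_iff_norm] at h1
    have := norm_le_norm_add_norm_sub' (z u) x
    linarith
  have hRB : ‖R t x‖ ≤ B := hB (t, x) ⟨ht, by simpa using hxM⟩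
  have hyv : fderiv ℝ G y (R t x) ≤ -(δ / 2) := by
    have h1 : |fderiv ℝ G y (R t x) - fderiv ℝ G x (R t x)| ≤ δ / 2 := by
      calc |fderiv ℝ G y (R t x) - fderiv ℝ G x (R t x)|
          = ‖(fderiv ℝ G y - fderiv ℝ G x) (R t x)‖ := rfl
        _ ≤ ‖fderiv ℝ G y - fderiv ℝ G x‖ * ‖R t x‖ := ContinuousLinearMap.le_opNorm _ _
        _ ≤ (Lg * (A * h)) * B := by
          gcongr
          exact (hLg.norm_sub_le (hball (by linarith)) (hball (by linarith))).trans
            (mul_le_mul_of_nonneg_left hyx Lg.coe_nonneg)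
        _ ≤ (Lg + 1) * A * B * h := by
          have : 0 ≤ A * B * h := by positivity
          linarith
        _ ≤ δ / 2 := hhδ
    have h2 := htube t ht x hx
    have := (abs_le.1 h1).2
    linarith
  have hτ : |M.target R G t x h - G y| ≤ C₁ * h ^ (p + 1) := by
    have h1 : |G (z (t + h)) - G y| ≤ LG * (C₀ * h ^ (p + 1)) :=
      (hLG.norm_sub_le (hball (by linarith [hzM (t + h)])) (hball (by linarith))).trans
        (mul_le_mul_of_nonneg_left hz1 LG.coe_nonneg)
    have h2 := abs_sub_le (M.target R G t x h) (G (z (t + h))) (G y)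
    rw [abs_sub_comm] at hz2
    rw [hC1, add_mul]
    linarith
  obtain ⟨hP, hex, hbd⟩ := existsUnique_projection (hG.differentiable (by simp))
    (M.stageSpan R t x h) (y := y) hB0 (half_pos hδ0) hρ0 Lg.coe_nonneg
    (Submodule.subset_span ⟨⟨0, hs⟩, M.stageDeriv_zero hs R t x h⟩) hRB hyv
    (fun w hw => hLg.norm_sub_le (hball (by
      have := norm_le_norm_add_norm_sub' w y
      linarith)) (hball (by linarith))) hLρ hτ
    ((mul_le_mul_of_nonneg_left hpow hC10.le).trans hhC)
  refine ⟨hP, hex, z, hzt, hzs.mono le_rfl (by linarith), fun lam hl1 hl2 => ?_, fun hth => ?_⟩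
  · have h1 : ‖M.projected R G t x h lam - y‖ ≤ C₁ * h ^ (p + 1) / κ := hbd lam hl1 hl2
    have h2 := norm_sub_le_norm_sub_add_norm_sub (M.projected R G t x h lam) y (z (t + h))
    rw [norm_sub_rev] at hz1
    have h3 : (C₀ + C₁ / κ) * h ^ (p + 1) = C₀ * h ^ (p + 1) + C₁ * h ^ (p + 1) / κ := by ring
    rw [h3]
    linarith
  · have h1 := IsSolutionOn.norm_sub_le hh.le
      (fun u hu => hL u ⟨ht.1.trans hu.1, hu.2.trans hth⟩) (hzs.mono le_rfl (by linarith))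
      (hq.mono ht.1 hth) (fun u _ => hball (by linarith [hzM u]))
      (fun u hu => hball (by linarith [hM0 u ⟨ht.1.trans hu.1, hu.2.trans hth⟩]))
    rwa [hzt] at h1

end ExplicitRK

/-! ### Runs of the method and the global error -/

namespace ExplicitRK

variable {s m p : ℕ} {M : ExplicitRK s}

/-- Projected runs can be extended as long as the projection equation is solvable along them. -/
theorem exists_isProjectedRun {R : ℝ → EuclideanSpace ℝ (Fin m) → EuclideanSpace ℝ (Fin m)}
    {G : EuclideanSpace ℝ (Fin m) → ℝ} {x₀ : EuclideanSpace ℝ (Fin m)} {h ρ : ℝ} {N : ℕ}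
    (hstep : ∀ n < N, ∀ Q, M.IsProjectedRun R G x₀ h ρ n Q →
      M.gradS R G (n * h) (Q n) h ≠ 0 ∧
        ∃ lam : ℝ, |lam| ≤ ρ ∧ M.IsProjectionParam R G (n * h) (Q n) h lam) :
    ∃ Q, M.IsProjectedRun R G x₀ h ρ N Q := by
  induction N with
  | zero => exact ⟨fun _ => x₀, rfl, by simp⟩
  | succ N ih =>
    obtain ⟨Q, hQ⟩ := ih fun n hn => hstep n (by omega)
    obtain ⟨hg, lam, hl1, hl2⟩ := hstep N (by omega) Q hQ
    refine ⟨Function.update Q (N + 1) (M.projected R G (N * h) (Q N) h lam), ?_, fun n hn => ?_⟩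
    · rw [Function.update_of_ne (by omega)]
      exact hQ.1
    · rw [Function.update_of_ne (by omega)]
      rcases Nat.lt_succ_iff_lt_or_eq.1 hn with hn' | rfl
      · rw [Function.update_of_ne (by omega)]
        exact hQ.2 n hn'
      · exact ⟨hg, lam, hl1, hl2, Function.update_self _ _ _⟩

end ExplicitRK

end

theorem mainTheorem4 {m s p : ℕ} (hp : 2 ≤ p)
    (M : ExplicitRK s) (hM : M.HasOrder p)
    (R : ℝ → EuclideanSpace ℝ (Fin m) → EuclideanSpace ℝ (Fin m))
    (hR : ContDiff ℝ ∞ (fun z : ℝ × EuclideanSpace ℝ (Fin m) => R z.1 z.2))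
    (G : EuclideanSpace ℝ (Fin m) → ℝ) (hG : ContDiff ℝ ∞ G)
    (T : ℝ) (hT : 0 < T)
    (q : ℝ → EuclideanSpace ℝ (Fin m)) (hq : IsSolutionOn R q 0 T)
    (hdiss : ∀ t ∈ Set.Icc 0 T, inner ℝ (gradient G (q t)) (R t (q t)) < 0) :
    ∃ hstar > 0, ∃ r > 0, ∃ ρ > 0, ∃ C > 0, ∀ h : ℝ, 0 < h → h ≤ hstar →
      -- one step, from any point close to the exact solution
      (∀ t ∈ Set.Icc 0 T, ∀ x : EuclideanSpace ℝ (Fin m), ‖x - q t‖ ≤ r →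
        M.gradS R G t x h ≠ 0 ∧
        (∃! lam : ℝ, |lam| ≤ ρ ∧ M.IsProjectionParam R G t x h lam) ∧
        ∃ z : ℝ → EuclideanSpace ℝ (Fin m), z t = x ∧ IsSolutionOn R z t (t + h) ∧
          ∀ lam : ℝ, |lam| ≤ ρ → M.IsProjectionParam R G t x h lam →
            ‖M.projected R G t x h lam - z (t + h)‖ ≤ C * h ^ (p + 1)) ∧
      -- the whole integration on the time interval
      (∀ N : ℕ, N * h ≤ T →
        (∃ Q : ℕ → EuclideanSpace ℝ (Fin m), M.IsProjectedRun R G (q 0) h ρ N Q) ∧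
        ∀ Q : ℕ → EuclideanSpace ℝ (Fin m), M.IsProjectedRun R G (q 0) h ρ N Q →
          ∀ n ≤ N, ‖Q n - q (n * h)‖ ≤ r ∧ ‖Q n - q (n * h)‖ ≤ C * h ^ p) := by
  obtain ⟨h₁, hh1, r, hr, ρ, hρ, C, hC, L, hstep⟩ :=
    hM.exists_projection_step (by omega) hR hG hT.le hq hdiss
  -- Up to time `T`, at most `T / h` local errors `C * h ^ (p + 1)` accumulate, each amplified by at
  -- most `exp (L * T)`. Requiring `h ≤ r / D` then keeps the total within the tube.
  set D : ℝ := C * T * Real.exp (L * T) with hD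
  have hD0 : 0 < D := by positivity
  refine ⟨min (min h₁ 1) (r / D), by positivity, r, hr, ρ, hρ, max C D, by positivity,
    fun h hh hle => ?_⟩
  have hle1 : h ≤ h₁ := hle.trans ((min_le_left _ _).trans (min_le_left _ _))
  have hle2 : h ≤ 1 := hle.trans ((min_le_left _ _).trans (min_le_right _ _))
  have hle3 : D * h ≤ r := by
    have := hle.trans (min_le_right _ _)
    rwa [le_div_iff₀ hD0, mul_comm] at this
  have hpow : h ^ p ≤ h := by
    simpa using pow_le_pow_of_le_one hh.le hle2 (show 1 ≤ p by omega)
  have hDr : D * h ^ p ≤ r := (mul_le_mul_of_nonneg_left hpow hD0.le).trans hle3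
  have hbound : ∀ n : ℕ, n * h ≤ T →
      C * (n * h ^ (p + 1)) * Real.exp (L * (n * h)) ≤ D * h ^ p := by
    intro n hn
    calc C * (n * h ^ (p + 1)) * Real.exp (L * (n * h))
        = C * (n * h) * Real.exp (L * (n * h)) * h ^ p := by ring
      _ ≤ C * T * Real.exp (L * T) * h ^ p := by gcongr
  -- Each step is compared with the exact solution `z` from `Q n`: the new local error is added to
  -- the old error carried by the flow. The bound at `n` also places `Q n` in the tube, which
  -- licenses the next step.
  have hrun : ∀ N : ℕ, N * h ≤ T → ∀ Q, M.IsProjectedRun R G (q 0) h ρ N Q → ∀ n ≤ N,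
      ‖Q n - q (n * h)‖ ≤ C * (n * h ^ (p + 1)) * Real.exp (L * (n * h)) := by
    intro N hN Q hQ n
    induction n with
    | zero => intro _; simp [hQ.1]
    | succ n ih =>
      intro hn
      have hnT : ((n + 1 : ℕ) : ℝ) * h ≤ T :=
        (mul_le_mul_of_nonneg_right (by exact_mod_cast hn) hh.le).trans hN
      have hs : ((n + 1 : ℕ) : ℝ) * h = n * h + h := by push_cast; ring
      rw [hs] at hnT ⊢
      have hnT' : n * h ≤ T := by linarith
      have hE := ih (by omega)
      obtain ⟨-, -, z, -, -, hz1, hz2⟩ := hstep h hh hle1 (n * h) ⟨by positivity, hnT'⟩ (Q n)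
        (hE.trans ((hbound n hnT').trans hDr))
      obtain ⟨-, lam, hl1, hl2, hQn⟩ := hQ.2 n (by omega)
      have h1 := hz1 lam hl1 hl2
      rw [← hQn] at h1
      have h2 := norm_sub_le_norm_sub_add_norm_sub (Q (n + 1)) (z (n * h + h)) (q (n * h + h))
      have h3 : ‖z (n * h + h) - q (n * h + h)‖
          ≤ C * (n * h ^ (p + 1)) * Real.exp (L * (n * h + h)) := by
        refine (hz2 hnT).trans ((mul_le_mul_of_nonneg_right hE (Real.exp_pos _).le).trans_eq ?_)
        rw [mul_assoc, ← Real.exp_add, mul_add]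
      have h4 : C * h ^ (p + 1) ≤ C * h ^ (p + 1) * Real.exp (L * (n * h + h)) :=
        le_mul_of_one_le_right (by positivity) (Real.one_le_exp (by positivity))
      calc ‖Q (n + 1) - q (n * h + h)‖ ≤ C * h ^ (p + 1) * Real.exp (L * (n * h + h))
            + C * (n * h ^ (p + 1)) * Real.exp (L * (n * h + h)) := by linarith
        _ = C * ((n + 1 : ℕ) * h ^ (p + 1)) * Real.exp (L * (n * h + h)) := by push_cast; ring
  refine ⟨fun t ht x hx => ?_, fun N hN => ⟨?_, fun Q hQ n hn => ?_⟩⟩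
  · obtain ⟨h1, h2, z, h3, h4, h5, -⟩ := hstep h hh hle1 t ht x hx
    exact ⟨h1, h2, z, h3, h4, fun lam hl1 hl2 => (h5 lam hl1 hl2).trans
      (mul_le_mul_of_nonneg_right (le_max_left _ _) (by positivity))⟩
  -- Any partial run already satisfies the error bound, hence ends inside the tube and can be
  -- extended.
  · refine ExplicitRK.exists_isProjectedRun fun n hn Q hQ => ?_
    have hnT : n * h ≤ T :=
      (mul_le_mul_of_nonneg_right (by exact_mod_cast hn.le) hh.le).trans hN
    obtain ⟨h1, h2, -⟩ := hstep h hh hle1 (n * h) ⟨by positivity, hnT⟩ (Q n)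
      ((hrun n hnT Q hQ n le_rfl).trans ((hbound n hnT).trans hDr))
    exact ⟨h1, h2.exists⟩
  · have hnT : n * h ≤ T :=
      (mul_le_mul_of_nonneg_right (by exact_mod_cast hn) hh.le).trans hN
    have h1 := (hrun N hN Q hQ n hn).trans (hbound n hnT)
    exact ⟨h1.trans hDr,
      h1.trans (mul_le_mul_of_nonneg_right (le_max_right _ _) (by positivity))⟩
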